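/- Fix a first-order alphabet: function symbols and predicate symbols with arities, and a countably infinite set of variables enumerated as $x_1,x_2,\dots$. A substitution is a homomorphic map on terms, i.e. an arbitrary map from variables to terms; $\lambda\sigma$ means "first $\lambda$, then $\sigma$". A logic program $P$ is a finite set of clauses $A\leftarrow A_1,\dots,A_k$ ($k\ge 0$) with distinct body atoms. Fix a selection rule, i.e. a function that picks one atom (occurrence) of every nonempty goal. An SLD-derivation resolves, at each step, the selected atom of the current goal with the head of a variant of a clause of $P$, whose variables do not appear earlier in the derivation (in its goals, clause variants or mgu's), using a most general unifier; an SLD-refutation is a finite SLD-derivation that ends in the empty goal, and its computed answer is the composite $\theta_1\theta_2\cdots\theta_N$ of its mgu's. For $n\in\mathbb N$ let $At(n)$ be the set of atoms whose variables are among $x_1,\dots,x_n$. For $A\in At(n)$, the $\&\vee_c$-tree for $A$ is the tree whose nodes of even height (and-nodes) are labelled by elements of $At(n)$ and whose root is labelled by $A$, and in which (i) an and-node labelled $B$ has exactly one child (an or-node) for each set $S=\{B_1\sigma,\dots,B_k\sigma\}\subseteq At(n)$ such that $B_0\leftarrow B_1,\dots,B_k$ is a clause of $P$ and $\sigma$ a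 substitution with $B_0\sigma=B$, and (ii) the children of that or-node are labelled by the elements of $S$, one for each. A derivation subtree is a set of nodes that contains the root, is closed under parents, contains at most one child of each of its and-nodes, and contains all children of each of its or-nodes. It is successful if it is finite and all its leaves are or-nodes. **Theorem (Soundness and completeness of SLD-refutations).** Let $P$ be a logic program and $G$ an atomic goal. 1. (Soundness) If there is an SLD-refutation for $G$ in $P$ with computed answer $\theta$, then for some $n$ with $G\theta\in At(n)$ the $\&\vee_c$-tree for $G\theta$ contains a successful derivation subtree. 2. (Completeness) For every substitution $\theta$ and every $n$ with $G\theta\in At(n)$: if the $\&\vee_c$-tree for $G\theta\in At(n)$ contains a successful derivation subtree, then there are an SLD-refutation for $G$ in $P$, with computed answer $\lambda$, and a substitution $\sigma$ such that $\lambda\sigma$ and $\theta$ agree on all variables of $G$. -/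

import Mathlib

universe u v

namespace CoLP

/-! ### Syntax: substitutions, atoms, clauses, programs

An alphabet is a first-order language `L` (function symbols and predicate symbols, each with an
arity).  The countably infinite set of variables is `ℕ`, and the terms are `L.Term ℕ`. -/

/-- A substitution, given by its values on the variables; `Term.subst` is the induced
homomorphic function on terms. -/
abbrev Subst (L : FirstOrder.Language.{u, v}) := ℕ → L.Term ℕ

namespace Subst

variable {L : FirstOrder.Language.{u, v}}

/-- The composite `θγ`: first apply `θ`, then `γ`. -/
def comp (θ γ : Subst L) : Subst L := fun x => (θ x).subst γ

/-- The identity substitution. -/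
def id : Subst L := fun x => FirstOrder.Language.Term.var x

/-- The variables that appear in a substitution, written as the set of its bindings `x / θ x`
with `θ x ≠ x`. -/
def vars (θ : Subst L) : Set ℕ :=
  {y | ∃ x, θ x ≠ FirstOrder.Language.Term.var x ∧ (y = x ∨ y ∈ (θ x).varFinset)}

end Subst

/-- An atomic formula `p(t₁, …, tₖ)`. -/
structure Atom (L : FirstOrder.Language.{u, v}) where
  arity : ℕ
  pred : L.Relations arity
  args : Fin arity → L.Term ℕ

namespace Atom

variable {L : FirstOrder.Language.{u, v}}

/-- The result `Aθ` of applying a substitution to an atom. -/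
def subst (A : Atom L) (θ : Subst L) : Atom L :=
  ⟨A.arity, A.pred, fun i => (A.args i).subst θ⟩

/-- The variables that occur in an atom. -/
def vars (A : Atom L) : Set ℕ := {x | ∃ i, x ∈ (A.args i).varFinset}

end Atom

/-- A clause `A ← A₁, …, Aₖ`. -/
structure Clause (L : FirstOrder.Language.{u, v}) where
  head : Atom L
  body : List (Atom L)

namespace Clause

variable {L : FirstOrder.Language.{u, v}}

/-- The result `Cθ` of applying a substitution to a clause. -/
def subst (C : Clause L) (θ : Subst L) : Clause L :=
  ⟨C.head.subst θ, C.body.map (·.subst θ)⟩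

/-- The variables that occur in a clause. -/
def vars (C : Clause L) : Set ℕ := C.head.vars ∪ {x | ∃ B ∈ C.body, x ∈ B.vars}

/-- `C'` is a variant of `C`: it is `Cρ` for a renaming `ρ` of variables that identifies no two
variables of `C`. -/
def IsVariant (C' C : Clause L) : Prop :=
  ∃ ρ : ℕ → ℕ, Set.InjOn ρ C.vars ∧ C' = C.subst (fun x => FirstOrder.Language.Term.var (ρ x))

end Clause

/-- A logic program: a finite set of clauses, the body of each consisting of distinct atoms. -/
structure Program (L : FirstOrder.Language.{u, v}) where
  clauses : Finset (Clause L)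
  nodup : ∀ C ∈ clauses, C.body.Nodup

/-! ### SLD-resolution -/

/-- A goal `← A₁, …, Aₖ`; the empty goal is `[]`.  (Instantiation may identify atoms, so
resolvents are arbitrary lists.) -/
abbrev Goal (L : FirstOrder.Language.{u, v}) := List (Atom L)

/-- `θ` is a unifier for the set `S` of atoms. -/
def IsUnifier {L : FirstOrder.Language.{u, v}} (θ : Subst L) (S : Set (Atom L)) : Prop :=
  ∀ A₁ ∈ S, ∀ A₂ ∈ S, A₁.subst θ = A₂.subst θ

/-- `θ` is a most general unifier for the set `S` of atoms. -/
def IsMGU {L : FirstOrder.Language.{u, v}} (θ : Subst L) (S : Set (Atom L)) : Prop :=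
  IsUnifier θ S ∧ ∀ σ, IsUnifier σ S → ∃ γ, σ = θ.comp γ

/-- A selection rule: it returns (the position of) the selected atom of any nonempty goal. -/
abbrev SelectionRule (L : FirstOrder.Language.{u, v}) := (G : Goal L) → G ≠ [] → Fin G.length

/-- `G'` is derived from `G` and `C` using the mgu `θ`, the atom being selected by `R`. -/
def DerivedFrom {L : FirstOrder.Language.{u, v}} (R : SelectionRule L) (G : Goal L) (C : Clause L)
    (θ : Subst L) (G' : Goal L) : Prop :=
  ∃ h : G ≠ [],
    IsMGU θ {G.get (R G h), C.head} ∧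
    G' = (G.take (R G h) ++ C.body ++ G.drop (R G h + 1)).map (·.subst θ)

/-- An SLD-derivation of length `N` of `P ∪ {G}` under the selection rule `R`: the goals
`goal 0 = G, …, goal N`, the variants `clause 0, …, clause (N - 1)` of program clauses and the
mgu's `mgu 0, …, mgu (N - 1)`; the values of the three sequences at later indices are irrelevant.
`clause i` and `mgu i` lead from `goal i` to `goal (i + 1)`. -/
structure SLDDerivation {L : FirstOrder.Language.{u, v}} (P : Program L) (R : SelectionRule L) (G : Goal L)
    (N : ℕ) where
  goal : ℕ → Goal L
  clause : ℕ → Clause L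
  mgu : ℕ → Subst L
  goal_zero : goal 0 = G
  variant : ∀ i < N, ∃ C ∈ P.clauses, (clause i).IsVariant C
  /-- Standardising apart: the variables of `clause i` do not appear in the derivation
  up to `goal i`. -/
  apart : ∀ i < N, ∀ x ∈ (clause i).vars,
    (∀ j ≤ i, ∀ A ∈ goal j, x ∉ A.vars) ∧
    (∀ j < i, x ∉ (clause j).vars) ∧
    (∀ j < i, x ∉ (mgu j).vars)
  step : ∀ i < N, DerivedFrom R (goal i) (clause i) (mgu i) (goal (i + 1))

/-- An SLD-refutation of length `N`: an SLD-derivation whose last goal is empty. -/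
structure SLDRefutation {L : FirstOrder.Language.{u, v}} (P : Program L) (R : SelectionRule L) (G : Goal L)
    (N : ℕ) extends SLDDerivation P R G N where
  goal_last : goal N = []

/-- The composite `θ₀ θ₁ ⋯ θ_{k-1}` of the first `k` members of a sequence of substitutions. -/
def composite {L : FirstOrder.Language.{u, v}} (θ : ℕ → Subst L) : ℕ → Subst L
  | 0 => Subst.id
  | k + 1 => (composite θ k).comp (θ k)

/-- The computed answer of an SLD-refutation: the composite of its mgu's. -/
def SLDRefutation.computedAnswer {L : FirstOrder.Language.{u, v}} {P : Program L} {R : SelectionRule L}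
    {G : Goal L} {N : ℕ} (D : SLDRefutation P R G N) : Subst L :=
  composite D.mgu N

/-! ### And-or trees -/

/-- A locally injective `X`-labelled and-or tree.  The nodes of even height `2k` are the
and-nodes, which are labelled; the nodes of odd height `2k + 1` are the or-nodes.  Each or-node has
finitely many children.  (Countability of the branching at and-nodes is the predicate
`CountablyBranching` below.) -/
structure AndOrTree (X : Type u) where
  /-- the nodes of height `2k` -/
  AndNode : ℕ → Type u
  /-- the nodes of height `2k + 1` -/
  OrNode : ℕ → Type u
  orParent : ∀ {k}, OrNode k → AndNode k
  andParent : ∀ {k}, AndNode (k + 1) → OrNode k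
  label : ∀ {k}, AndNode k → X
  root : AndNode 0
  root_unique : ∀ x : AndNode 0, x = root
  finite_children : ∀ {k} (y : OrNode k), {x : AndNode (k + 1) | andParent x = y}.Finite
  /-- the children of an or-node have distinct labels -/
  or_injective : ∀ {k} (x x' : AndNode (k + 1)),
    andParent x = andParent x' → label x = label x' → x = x'
  /-- distinct children of an and-node have distinct sets of labels of their children -/
  and_injective : ∀ {k} (y y' : OrNode k), orParent y = orParent y' →
    label '' {x : AndNode (k + 1) | andParent x = y} =
      label '' {x : AndNode (k + 1) | andParent x = y'} → y = y'

/-- Every and-node has only countably many children. -/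
def AndOrTree.CountablyBranching {X : Type u} (T : AndOrTree X) : Prop :=
  ∀ k (x : T.AndNode k), {y : T.OrNode k | T.orParent y = x}.Countable

/-- For `c : X → 𝒫(P_f X)`, `Path c a k b` is the type of paths
`a = b₀, S₁ ∈ c b₀, b₁ ∈ S₁, …, S_k ∈ c b_{k-1}, b_k = b` with `b_k ∈ S_k`. -/
inductive Path {X : Type u} (c : X → Set (Finset X)) (a : X) : ℕ → X → Type u
  | root : Path c a 0 a
  | step {k : ℕ} {b : X} (p : Path c a k b) (S : Finset X) (hS : S ∈ c b)
      (b' : X) (hb : b' ∈ S) : Path c a (k + 1) b'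

/-- The or-node above the endpoint of a nontrivial path. -/
def Path.parent {X : Type u} {c : X → Set (Finset X)} {a : X} {k : ℕ} :
    (Σ b, Path c a (k + 1) b) → (Σ x : (Σ b, Path c a k b), {S : Finset X // S ∈ c x.1})
  | ⟨_, .step p S hS _ _⟩ => ⟨⟨_, p⟩, ⟨S, hS⟩⟩

theorem Path.eq_of_parent_eq {X : Type u} {c : X → Set (Finset X)} {a : X} {k : ℕ}
    (x x' : Σ b, Path c a (k + 1) b) (h : Path.parent x = Path.parent x') (hl : x.1 = x'.1) :
    x = x' := by
  obtain ⟨b, _ | ⟨p, S, hS, _, hb⟩⟩ := x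
  obtain ⟨b', _ | ⟨p', S', hS', _, hb'⟩⟩ := x'
  simp only at hl
  subst hl
  simp only [Path.parent, Sigma.mk.injEq] at h
  obtain ⟨⟨h1, h2⟩, h3⟩ := h
  subst h1
  have h2 := eq_of_heq h2
  subst h2
  have h3 := eq_of_heq h3
  simp only [Subtype.mk.injEq] at h3
  subst h3
  rfl

theorem Path.image_children {X : Type u} {c : X → Set (Finset X)} {a : X} {k : ℕ}
    (y : Σ x : (Σ b, Path c a k b), {S : Finset X // S ∈ c x.1}) :
    (fun x : (Σ b, Path c a (k + 1) b) => x.1) '' {x | Path.parent x = y} = (y.2.1 : Set X) := by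
  ext b
  constructor
  · rintro ⟨⟨b', _ | ⟨p, S, hS, _, hb⟩⟩, rfl, rfl⟩
    exact hb
  · intro hb
    exact ⟨⟨b, .step y.1.2 y.2.1 y.2.2 b hb⟩, rfl, rfl⟩

/-- The and-or tree generated by `c : X → 𝒫(P_f X)` and `a : X`.  Its root is labelled by `a`; an
and-node labelled by `b` has one child for each element `S` of `c b`; the children of that or-node
are labelled by the elements of `S`, one for each. -/
def unfold {X : Type u} (c : X → Set (Finset X)) (a : X) : AndOrTree X where
  AndNode k := Σ b, Path c a k b
  OrNode k := Σ x : (Σ b, Path c a k b), {S : Finset X // S ∈ c x.1}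
  orParent y := y.1
  andParent x := Path.parent x
  label x := x.1
  root := ⟨a, .root⟩
  root_unique := by rintro ⟨_, _ | _⟩; rfl
  finite_children y := by
    refine Set.Finite.of_finite_image (f := fun x => x.1) ?_ ?_
    · rw [Path.image_children]
      exact y.2.1.finite_toSet
    · intro x hx x' hx' h
      exact Path.eq_of_parent_eq x x' (hx.trans hx'.symm) h
  or_injective x x' h hl := Path.eq_of_parent_eq x x' h hl
  and_injective := by
    rintro k ⟨x, S, hS⟩ ⟨x', S', hS'⟩ h hl
    rw [Path.image_children, Path.image_children] at hl
    simp only at h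
    subst h
    simp only [Finset.coe_inj] at hl
    subst hl
    rfl

theorem unfold_countablyBranching {X : Type u} (c : X → Set (Finset X))
    (hc : ∀ b, (c b).Countable) (a : X) : (unfold c a).CountablyBranching := by
  intro k x
  have : Countable {S : Finset X // S ∈ c x.1} := (hc x.1).to_subtype
  refine (Set.countable_range
    (fun S : {S : Finset X // S ∈ c x.1} => (⟨x, S⟩ : (unfold c a).OrNode k))).mono ?_
  rintro ⟨x', S⟩ rfl
  exact ⟨S, rfl⟩

/-! ### The tree of a program -/

/-- `At(n)`: the atoms all of whose variables are among the first `n` variables. -/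
def At (L : FirstOrder.Language.{u, v}) (n : ℕ) : Set (Atom L) := {A | ∀ x ∈ A.vars, x < n}

/-- The coalgebra `p : At(n) → P_c P_f At(n)` of a program: `A` is sent to the set of sets of
antecedents in those substitution instances of program clauses, over the variables among the
first `n`, whose head is `A`. -/
def Program.coalgebra {L : FirstOrder.Language.{u, v}} (P : Program L) (n : ℕ) (A : At L n) :
    Set (Finset (At L n)) :=
  {S | ∃ C ∈ P.clauses, ∃ σ : Subst L, C.head.subst σ = A ∧
    Subtype.val '' (S : Set (At L n)) = {B | ∃ B₀ ∈ C.body, B₀.subst σ = B}}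

/-- The and-or tree `p̄(A)` determined by the program `P` and the atom `A ∈ At(n)`. -/
def Program.tree {L : FirstOrder.Language.{u, v}} (P : Program L) (n : ℕ) (A : At L n) :
    AndOrTree (At L n) :=
  unfold (P.coalgebra n) A

/-- Over a countable alphabet the trees of a program are countably branching at and-nodes. -/
theorem Program.tree_countablyBranching {L : FirstOrder.Language.{u, v}}
    [Countable (Σ k, L.Functions k)] [Countable (Σ k, L.Relations k)]
    (P : Program L) (n : ℕ) (A : At L n) : (P.tree n A).CountablyBranching := by
  have hinj : Function.Injective
      (fun A : Atom L => (⟨⟨A.arity, A.pred⟩, A.args⟩ :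
        Σ r : (Σ k, L.Relations k), (Fin r.1 → L.Term ℕ))) := by
    rintro ⟨k, r, t⟩ ⟨k', r', t'⟩ h
    simp only [Sigma.mk.injEq] at h
    obtain ⟨⟨rfl, h1⟩, h2⟩ := h
    cases eq_of_heq h1
    cases eq_of_heq h2
    rfl
  have : Countable (Atom L) := hinj.countable
  exact unfold_countablyBranching _ (fun b => Set.to_countable _) A

/-- A derivation subtree: a set of nodes that contains the root and is closed under parents, such
that at most one child of each of its and-nodes, and all children of each of its or-nodes, belong
to it. -/
structure DerivationSubtree {X : Type u} (T : AndOrTree X) where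
  andNodes : ∀ k, Set (T.AndNode k)
  orNodes : ∀ k, Set (T.OrNode k)
  root_mem : T.root ∈ andNodes 0
  orParent_mem : ∀ k, ∀ y ∈ orNodes k, T.orParent y ∈ andNodes k
  andParent_mem : ∀ k, ∀ x ∈ andNodes (k + 1), T.andParent x ∈ orNodes k
  at_most_one : ∀ k, ∀ y ∈ orNodes k, ∀ y' ∈ orNodes k, T.orParent y = T.orParent y' → y = y'
  all_children : ∀ k, ∀ x : T.AndNode (k + 1), T.andParent x ∈ orNodes k → x ∈ andNodes (k + 1)

/-- A derivation subtree is successful if it is finite and its leaves are all or-nodes, i.e. no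
and-node is a leaf of it. -/
def DerivationSubtree.Successful {X : Type u} {T : AndOrTree X} (T' : DerivationSubtree T) :
    Prop :=
  {x : Σ k, T.AndNode k | x.2 ∈ T'.andNodes x.1}.Finite ∧
  {y : Σ k, T.OrNode k | y.2 ∈ T'.orNodes y.1}.Finite ∧
  ∀ k, ∀ x ∈ T'.andNodes k, ∃ y ∈ T'.orNodes k, T.orParent y = x

end CoLP

/-!
Both halves pass through one notion, `Program.Provable`: an atom is provable in `At(n)` if it has a
finite proof from instances of the program clauses, all of whose atoms belong to `At(n)`.

*Trees and proofs.*  A successful derivation subtree is such a proof: induct downwards on the levels,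
of which there are finitely many (`Program.exists_provable_of_successful`).  Conversely, choosing for
each provable atom the last step of a proof of least height determines a derivation subtree in which
these heights decrease; it branches finitely, hence is finite
(`Program.exists_successful_of_provable`).

*Soundness.*  Backwards along a refutation, the atoms of each goal become provable when the mgu's that
are still to come are applied, since the mgu of a step turns the selected atom into the head of an
instance of a program clause (`SLDRefutation.eventually_provable`).  A refutation involves finitely
many atoms, so that one `n` is large enough for all of them.

*Completeness.*  The invariant is a derivation together with a substitution `τ` under which its last
goal is provable and such that the composite of the mgu's, followed by `τ`, agrees with `θ` on the
variables of `G`.  Whichever atom is selected, its `τ`-instance is the head of a clause instance with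
provable body.  Taking a variant of the clause in unused variables, `τ` extends to a unifier of the
selected atom and the head of the variant, and so factors through an mgu; the other factor is the
next `τ` (`SLDDerivation.exists_lift`).  The process ends because provable atoms carry weights that
exceed the total weight of the body from which they are proved (`Program.exists_weight`), so that the
order in which atoms are selected does not matter.  Unused variables exist because the mgu's can be
taken to move only finitely many variables (`exists_isMGU`).
-/

namespace CoLP

open FirstOrder.Language Filter

variable {L : FirstOrder.Language.{u, v}}

/-! ### Substitutions on terms, atoms and clauses -/

theorem term_subst_comp (t : L.Term ℕ) (θ γ : Subst L) :
    t.subst (θ.comp γ) = (t.subst θ).subst γ := by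
  induction t with
  | var x => rfl
  | func f ts ih => simp [Term.subst, ih]

theorem term_subst_congr {t : L.Term ℕ} {θ γ : Subst L} (h : ∀ x ∈ t.varFinset, θ x = γ x) :
    t.subst θ = t.subst γ := by
  induction t with
  | var x => exact h x (by simp [Term.varFinset])
  | func f ts ih =>
    simp only [Term.subst, Term.func.injEq, heq_eq_eq, true_and]
    funext i
    refine ih i fun x hx => h x ?_
    simpa [Term.varFinset] using ⟨i, hx⟩

theorem term_subst_id (t : L.Term ℕ) : t.subst Subst.id = t := by
  induction t with
  | var x => rfl
  | func f ts ih => simp [Term.subst, ih]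

theorem mem_varFinset_subst {t : L.Term ℕ} {θ : Subst L} {y : ℕ} :
    y ∈ (t.subst θ).varFinset ↔ ∃ x ∈ t.varFinset, y ∈ (θ x).varFinset := by
  induction t with
  | var x => simp [Term.subst, Term.varFinset]
  | func f ts ih =>
    simp only [Term.subst, Term.varFinset, Finset.mem_biUnion, Finset.mem_univ, true_and, ih]
    exact ⟨fun ⟨i, x, hx, hy⟩ => ⟨x, ⟨i, hx⟩, hy⟩, fun ⟨x, ⟨i, hx⟩, hy⟩ => ⟨i, x, hx, hy⟩⟩

theorem Subst.comp_assoc (θ γ δ : Subst L) : (θ.comp γ).comp δ = θ.comp (γ.comp δ) :=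
  funext fun x => (term_subst_comp (θ x) γ δ).symm

theorem Subst.comp_id (θ : Subst L) : θ.comp Subst.id = θ :=
  funext fun x => term_subst_id (θ x)

theorem Atom.subst_comp (A : Atom L) (θ γ : Subst L) :
    A.subst (θ.comp γ) = (A.subst θ).subst γ := by
  simp [Atom.subst, term_subst_comp]

theorem Atom.subst_congr {A : Atom L} {θ γ : Subst L} (h : ∀ x ∈ A.vars, θ x = γ x) :
    A.subst θ = A.subst γ := by
  simp only [Atom.subst, Atom.mk.injEq, heq_eq_eq, true_and]
  exact funext fun i => term_subst_congr fun x hx => h x ⟨i, hx⟩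

theorem Atom.finite_vars (A : Atom L) : A.vars.Finite := by
  have : A.vars = ⋃ i, ((A.args i).varFinset : Set ℕ) := by
    ext x; simp [Atom.vars]
  rw [this]
  exact Set.finite_iUnion fun i => Finset.finite_toSet _

theorem Atom.mem_vars_subst {A : Atom L} {θ : Subst L} {y : ℕ} :
    y ∈ (A.subst θ).vars ↔ ∃ x ∈ A.vars, y ∈ (θ x).varFinset := by
  simp only [Atom.vars, Atom.subst, Set.mem_ofPred_eq, mem_varFinset_subst]
  exact ⟨fun ⟨i, x, hx, hy⟩ => ⟨x, ⟨i, hx⟩, hy⟩, fun ⟨x, ⟨i, hx⟩, hy⟩ => ⟨i, x, hx, hy⟩⟩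

theorem Clause.finite_vars (C : Clause L) : C.vars.Finite := by
  refine C.head.finite_vars.union ?_
  have : {x | ∃ B ∈ C.body, x ∈ B.vars} = ⋃ B ∈ {B | B ∈ C.body}, B.vars := by
    ext x; simp
  rw [this]
  exact (List.finite_toSet C.body).biUnion fun B _ => B.finite_vars

theorem Subst.finite_vars {θ : Subst L} (h : {x | θ x ≠ Term.var x}.Finite) : θ.vars.Finite := by
  refine (h.biUnion (t := fun x => insert x ((θ x).varFinset : Set ℕ))
    fun x _ => (Finset.finite_toSet _).insert x).subset ?_
  rintro y ⟨x, hx, hy⟩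
  exact Set.mem_biUnion hx (by simpa using hy)

/-- A variable of an instance `t θ` either occurs in `t` or appears in `θ`. -/
theorem mem_or_mem_vars_of_mem_subst {t : L.Term ℕ} {θ : Subst L} {y : ℕ}
    (hy : y ∈ (t.subst θ).varFinset) : y ∈ t.varFinset ∨ y ∈ θ.vars := by
  obtain ⟨x, hx, hy⟩ := mem_varFinset_subst.1 hy
  by_cases h : θ x = Term.var x
  · rw [h] at hy
    obtain rfl : y = x := by simpa [Term.varFinset] using hy
    exact .inl hx
  · exact .inr ⟨x, h, .inr hy⟩

/-! ### Unification -/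

/-- The number of symbols of a term. -/
def termSize : L.Term ℕ → ℕ
  | .var _ => 1
  | .func _ ts => 1 + ∑ i, termSize (ts i)

theorem termSize_pos (t : L.Term ℕ) : 0 < termSize t := by
  cases t <;> simp [termSize]

theorem termSize_le_of_mem_varFinset {t : L.Term ℕ} {x : ℕ} (hx : x ∈ t.varFinset) (θ : Subst L) :
    termSize (θ x) ≤ termSize (t.subst θ) := by
  induction t with
  | var y =>
    obtain rfl : x = y := by simpa [Term.varFinset] using hx
    exact le_rfl
  | func f ts ih =>
    obtain ⟨i, hi⟩ : ∃ i, x ∈ (ts i).varFinset := by simpa [Term.varFinset] using hx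
    have := Finset.single_le_sum (f := fun i => termSize ((ts i).subst θ))
      (fun _ _ => Nat.zero_le _) (Finset.mem_univ i)
    simp only [Term.subst, termSize]
    have := ih i hi
    omega

/-- The occurs check: a variable that occurs properly in a term does not unify with it. -/
theorem notMem_varFinset_of_subst_eq {t : L.Term ℕ} {x : ℕ} {θ : Subst L}
    (h : θ x = t.subst θ) (ht : t ≠ Term.var x) : x ∉ t.varFinset := by
  intro hx
  cases t with
  | var y => simp_all [Term.varFinset]
  | func f ts =>
    obtain ⟨i, hi⟩ : ∃ i, x ∈ (ts i).varFinset := by simpa [Term.varFinset] using hx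
    have h1 := termSize_le_of_mem_varFinset hi θ
    have h2 := Finset.single_le_sum (f := fun i => termSize ((ts i).subst θ))
      (fun _ _ => Nat.zero_le _) (Finset.mem_univ i)
    rw [h] at h1
    simp only [Term.subst, termSize] at h1
    omega

/-- `θ` solves a list of equations between terms. -/
def Solves (θ : Subst L) (E : List (L.Term ℕ × L.Term ℕ)) : Prop :=
  ∀ e ∈ E, e.1.subst θ = e.2.subst θ

/-- `θ` is a most general solution of a list of equations, and moves only finitely many
variables. -/
def IsFiniteMGS (θ : Subst L) (E : List (L.Term ℕ × L.Term ℕ)) : Prop :=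
  {x | θ x ≠ Term.var x}.Finite ∧ Solves θ E ∧ ∀ σ, Solves σ E → ∃ γ, σ = θ.comp γ

theorem IsFiniteMGS.congr {θ : Subst L} {E E' : List (L.Term ℕ × L.Term ℕ)}
    (h : IsFiniteMGS θ E) (hE : ∀ σ, Solves σ E ↔ Solves σ E') : IsFiniteMGS θ E' :=
  ⟨h.1, (hE _).1 h.2.1, fun σ hσ => h.2.2 σ ((hE σ).2 hσ)⟩

/-- The substitution with the single binding `x / t`. -/
def single (x : ℕ) (t : L.Term ℕ) : Subst L := Function.update Subst.id x t

theorem single_comp {x : ℕ} {t : L.Term ℕ} {θ : Subst L} (h : θ x = t.subst θ) :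
    (single x t).comp θ = θ := by
  funext y
  by_cases hy : y = x
  · subst hy
    simp [Subst.comp, single, h]
  · simp [Subst.comp, single, hy, Subst.id, Term.subst]

theorem subst_single_of_notMem {x : ℕ} {s t : L.Term ℕ} (h : x ∉ s.varFinset) :
    s.subst (single x t) = s := by
  conv_rhs => rw [← term_subst_id s]
  refine term_subst_congr fun y hy => ?_
  have : y ≠ x := by rintro rfl; exact h hy
  simp [single, this]

theorem solves_cons {θ : Subst L} {s t : L.Term ℕ} {E : List (L.Term ℕ × L.Term ℕ)} :
    Solves θ ((s, t) :: E) ↔ s.subst θ = t.subst θ ∧ Solves θ E := by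
  simp [Solves]

theorem solves_append {θ : Subst L} {E E' : List (L.Term ℕ × L.Term ℕ)} :
    Solves θ (E ++ E') ↔ Solves θ E ∧ Solves θ E' := by
  simp only [Solves, List.mem_append]
  exact ⟨fun h => ⟨fun e he => h e (.inl he), fun e he => h e (.inr he)⟩,
    fun h e he => he.elim (h.1 e) (h.2 e)⟩

theorem solves_ofFn {θ : Subst L} {k : ℕ} {s t : Fin k → L.Term ℕ} :
    Solves θ (List.ofFn fun i => (s i, t i)) ↔ ∀ i, (s i).subst θ = (t i).subst θ := by
  simp [Solves, List.mem_ofFn]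

theorem solves_map_subst {θ γ : Subst L} {E : List (L.Term ℕ × L.Term ℕ)} :
    Solves γ (E.map fun e => (e.1.subst θ, e.2.subst θ)) ↔ Solves (θ.comp γ) E := by
  simp only [Solves, List.forall_mem_map, term_subst_comp]

/-- The elimination of a variable: an equation `x = t` in which `x` does not occur in `t` is
solved by the binding `x / t`, which is then applied to the other equations. -/
theorem IsFiniteMGS.eliminate {x : ℕ} {t : L.Term ℕ} {θ : Subst L}
    {E : List (L.Term ℕ × L.Term ℕ)} (ht : x ∉ t.varFinset)
    (h : IsFiniteMGS θ (E.map fun e => (e.1.subst (single x t), e.2.subst (single x t)))) :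
    IsFiniteMGS ((single x t).comp θ) ((Term.var x, t) :: E) := by
  refine ⟨?_, ?_, fun σ hσ => ?_⟩
  · refine (h.1.insert x).subset fun y hy => ?_
    by_cases hyx : y = x
    · exact .inl hyx
    · exact .inr (by simpa [Subst.comp, single, hyx, Subst.id, Term.subst] using hy)
  · refine solves_cons.2 ⟨?_, solves_map_subst.1 h.2.1⟩
    rw [term_subst_comp, term_subst_comp, subst_single_of_notMem ht]
    simp [Term.subst, single]
  · obtain ⟨h1, h2⟩ := solves_cons.1 hσ
    have hs := single_comp (θ := σ) h1
    obtain ⟨γ, hγ⟩ := h.2.2 σ (solves_map_subst.2 (by rwa [hs]))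
    exact ⟨γ, by rw [Subst.comp_assoc, ← hγ, hs]⟩

/-- Solvable equations have a most general solution.  Given a fixed solution `τ`, each step of the
unification algorithm decreases the total size of the `τ`-instances of the left hand sides: the
elimination of a variable does not change the `τ`-instances of the equations that remain. -/
theorem exists_isFiniteMGS (τ : Subst L) : ∀ (m : ℕ) (E : List (L.Term ℕ × L.Term ℕ)),
    Solves τ E → (E.map fun e => termSize (e.1.subst τ)).sum ≤ m → ∃ θ, IsFiniteMGS θ E := by
  intro m
  induction m with
  | zero =>
    rintro (_ | ⟨⟨s, t⟩, E⟩) hE hm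
    · exact ⟨Subst.id, by simp [Subst.id], by simp [Solves],
        fun σ _ => ⟨σ, rfl⟩⟩
    · have := termSize_pos (s.subst τ)
      simp at hm
      omega
  | succ m ih =>
    -- The case of an equation whose left hand side is a variable.
    have key : ∀ (x : ℕ) (t : L.Term ℕ) (E : List (L.Term ℕ × L.Term ℕ)),
        Solves τ ((Term.var x, t) :: E) →
        (E.map fun e => termSize (e.1.subst τ)).sum ≤ m →
        ∃ θ, IsFiniteMGS θ ((Term.var x, t) :: E) := by
      intro x t E hE hm
      obtain ⟨h1, h2⟩ := solves_cons.1 hE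
      by_cases ht : t = Term.var x
      · obtain ⟨θ, hθ⟩ := ih E h2 hm
        exact ⟨θ, hθ.congr fun σ => by rw [solves_cons, ht]; simp⟩
      · have hs := single_comp (θ := τ) h1
        obtain ⟨θ, hθ⟩ := ih _ (solves_map_subst.2 (hs.symm ▸ h2)) (by
          simpa [Function.comp_def, ← term_subst_comp, hs] using hm)
        exact ⟨_, hθ.eliminate (notMem_varFinset_of_subst_eq h1 ht)⟩
    rintro (_ | ⟨⟨s, t⟩, E⟩) hE hm
    · exact ih [] hE (by simp)
    obtain ⟨h1, h2⟩ := solves_cons.1 hE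
    have hpos := termSize_pos (s.subst τ)
    simp only [List.map_cons, List.sum_cons] at hm
    match s, t with
    | .var x, t => exact key x t E hE (by omega)
    | .func f ss, .var x =>
      obtain ⟨θ, hθ⟩ := key x (.func f ss) E (solves_cons.2 ⟨h1.symm, h2⟩) (by omega)
      exact ⟨θ, hθ.congr fun σ => by rw [solves_cons, solves_cons, eq_comm]⟩
    | .func (l := k) f ss, .func (l := k') g ts =>
      simp only [Term.subst, Term.func.injEq] at h1
      obtain ⟨rfl, h3, h4⟩ := h1
      obtain rfl := eq_of_heq h3
      have h4 := fun i => congrFun (eq_of_heq h4) i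
      obtain ⟨θ, hθ⟩ := ih ((List.ofFn fun i => (ss i, ts i)) ++ E)
        (solves_append.2 ⟨solves_ofFn.2 h4, h2⟩) (by
          simp only [Term.subst, termSize] at hm
          simp only [List.map_append, List.sum_append, List.map_ofFn, List.sum_ofFn,
            Function.comp_apply]
          omega)
      refine ⟨θ, hθ.congr fun σ => ?_⟩
      rw [solves_append, solves_ofFn, solves_cons]
      simp [Term.subst, funext_iff]

theorem Atom.subst_eq_subst_iff {p : ℕ} {r : L.Relations p} {s t : Fin p → L.Term ℕ}
    {θ : Subst L} : (Atom.mk p r s).subst θ = (Atom.mk p r t).subst θ ↔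
      Solves θ (List.ofFn fun i => (s i, t i)) := by
  simp [solves_ofFn, Atom.subst, funext_iff]

theorem isUnifier_pair {θ : Subst L} {A B : Atom L} :
    IsUnifier θ {A, B} ↔ A.subst θ = B.subst θ := by
  simp only [IsUnifier, Set.mem_insert_iff, Set.mem_singleton_iff, forall_eq_or_imp, forall_eq,
    true_and, and_true]
  exact ⟨fun h => h.1, fun h => ⟨h, h.symm⟩⟩

/-- The unification theorem: two unifiable atoms have a most general unifier, in which only finitely
many variables appear. -/
theorem exists_isMGU {A B : Atom L} {τ : Subst L} (h : A.subst τ = B.subst τ) :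
    ∃ θ : Subst L, θ.vars.Finite ∧ IsMGU θ {A, B} := by
  obtain ⟨p, r, s⟩ := A
  obtain ⟨p', r', t⟩ := B
  have h' := h
  simp only [Atom.subst, Atom.mk.injEq] at h'
  obtain ⟨rfl, hr, -⟩ := h'
  obtain rfl := eq_of_heq hr
  obtain ⟨θ, h1, h2, h3⟩ := exists_isFiniteMGS τ _ _ (Atom.subst_eq_subst_iff.1 h) le_rfl
  exact ⟨θ, Subst.finite_vars h1, isUnifier_pair.2 (Atom.subst_eq_subst_iff.2 h2),
    fun σ hσ => h3 σ (Atom.subst_eq_subst_iff.1 (isUnifier_pair.1 hσ))⟩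

/-! ### Derivation subtrees of and-or trees -/

section Trees

variable {X : Type u}

theorem DerivationSubtree.finite_orNodes_of_finite_andNodes {T : AndOrTree X}
    (T' : DerivationSubtree T) {k : ℕ} (h : (T'.andNodes k).Finite) : (T'.orNodes k).Finite :=
  Set.Finite.of_injOn (f := T.orParent) (fun y hy => T'.orParent_mem k y hy)
    (fun y hy y' hy' => T'.at_most_one k y hy y' hy') h

/-- A derivation subtree branches finitely, so that each of its levels is finite. -/
theorem DerivationSubtree.finite_andNodes {T : AndOrTree X} (T' : DerivationSubtree T) (k : ℕ) :
    (T'.andNodes k).Finite := by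
  induction k with
  | zero => exact (Set.finite_singleton T.root).subset fun x _ => T.root_unique x
  | succ k ih =>
    refine ((T'.finite_orNodes_of_finite_andNodes ih).biUnion
      fun y _ => T.finite_children y).subset fun x hx => ?_
    exact Set.mem_biUnion (T'.andParent_mem k x hx) rfl

theorem finite_sigma_of_bounded {F : ℕ → Type u} {s : ∀ k, Set (F k)} {K : ℕ}
    (hs : ∀ k, (s k).Finite) (hK : ∀ k, ∀ x ∈ s k, k ≤ K) :
    {x : Σ k, F k | x.2 ∈ s x.1}.Finite := by
  refine ((Set.finite_Iic K).biUnion (t := fun k => Sigma.mk k '' s k)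
    fun k _ => (hs k).image _).subset ?_
  rintro ⟨k, x⟩ hx
  exact Set.mem_biUnion (hK k x hx) ⟨x, hx, rfl⟩

variable {c : X → Set (Finset X)} {a : X}

/-- The path chooses the set `s b` at each of its members `b` but the last. -/
def Path.Follows (s : X → Finset X) : ∀ {k : ℕ} {b : X}, Path c a k b → Prop
  | _, _, .root => True
  | _, _, .step (b := b) p S _ _ _ => p.Follows s ∧ S = s b

theorem Path.Follows.good {s : X → Finset X} {good : X → Prop} {rk : X → ℕ} (ha : good a)
    (hs : ∀ b, good b → ∀ b' ∈ s b, good b' ∧ rk b' < rk b) {k : ℕ} {b : X} {p : Path c a k b}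
    (hp : p.Follows s) : good b ∧ rk b + k ≤ rk a := by
  induction p with
  | root => exact ⟨ha, le_rfl⟩
  | step p S hS b' hb ih =>
    obtain ⟨hp, rfl⟩ := hp
    obtain ⟨h1, h2⟩ := ih hp
    obtain ⟨h3, h4⟩ := hs _ h1 _ hb
    exact ⟨h3, by omega⟩

/-- The derivation subtree of `unfold c a` determined by a choice `s b` of an or-node below each
and-node labelled `b`. -/
def followSubtree (c : X → Set (Finset X)) (a : X) (s : X → Finset X) :
    DerivationSubtree (unfold c a) where
  andNodes k := {x : Σ b, Path c a k b | x.2.Follows s}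
  orNodes k := {y : Σ x : (Σ b, Path c a k b), {S : Finset X // S ∈ c x.1} |
    y.1.2.Follows s ∧ y.2.1 = s y.1.1}
  root_mem := trivial
  orParent_mem _ _ hy := hy.1
  andParent_mem := by
    rintro k ⟨b', _ | ⟨p, S, hS, _, hb⟩⟩ hx
    exact hx
  at_most_one := by
    rintro k ⟨x, S, hS⟩ ⟨-, hy⟩ ⟨x', S', hS'⟩ ⟨-, hy'⟩ h
    obtain rfl : x = x' := h
    obtain rfl : S = s x.1 := hy
    obtain rfl : S' = s x.1 := hy'
    rfl
  all_children := by
    rintro k ⟨b', _ | ⟨p, S, hS, _, hb⟩⟩ hx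
    exact hx

/-- If the choice is possible at the good labels and leads to good labels of smaller rank, then the
derivation subtree that it determines is successful. -/
theorem followSubtree_successful {s : X → Finset X} {good : X → Prop} {rk : X → ℕ} (ha : good a)
    (hc : ∀ b, good b → s b ∈ c b)
    (hs : ∀ b, good b → ∀ b' ∈ s b, good b' ∧ rk b' < rk b) :
    (followSubtree c a s).Successful := by
  have hK : ∀ k, ∀ x ∈ (followSubtree c a s).andNodes k, k ≤ rk a := by
    rintro k ⟨b, p⟩ hx
    have := (Path.Follows.good (p := p) ha hs hx).2
    omega
  refine ⟨finite_sigma_of_bounded (fun k => DerivationSubtree.finite_andNodes _ k) hK,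
    finite_sigma_of_bounded
      (fun k => DerivationSubtree.finite_orNodes_of_finite_andNodes _
        (DerivationSubtree.finite_andNodes _ k))
      fun k y hy => hK k _ (DerivationSubtree.orParent_mem _ k y hy), ?_⟩
  rintro k ⟨b, p⟩ hx
  have hb := (Path.Follows.good (p := p) ha hs hx).1
  exact ⟨⟨⟨b, p⟩, s b, hc b hb⟩, ⟨hx, rfl⟩, rfl⟩

end Trees

/-! ### Provable atoms -/

/-- `P.Provable n k A`: the atom `A` has a proof of height at most `k` from instances of clauses of
`P`, in which all atoms belong to `At(n)`. -/
def Program.Provable (P : Program L) (n : ℕ) : ℕ → Atom L → Prop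
  | 0, _ => False
  | k + 1, A => A ∈ At L n ∧ ∃ C ∈ P.clauses, ∃ σ : Subst L, C.head.subst σ = A ∧
      ∀ B ∈ C.body, P.Provable n k (B.subst σ)

theorem Program.Provable.mem_At {P : Program L} {n k : ℕ} {A : Atom L} (h : P.Provable n k A) :
    A ∈ At L n := by
  cases k with
  | zero => exact h.elim
  | succ k => exact h.1

theorem Program.Provable.mono {P : Program L} {n n' k k' : ℕ} {A : Atom L}
    (h : P.Provable n k A) (hn : n ≤ n') (hk : k ≤ k') : P.Provable n' k' A := by
  induction k generalizing A k' with
  | zero => exact h.elim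
  | succ k ih =>
    obtain ⟨k', rfl⟩ : ∃ j, k' = j + 1 := ⟨k' - 1, by omega⟩
    obtain ⟨hA, C, hC, σ, hσ, hB⟩ := h
    exact ⟨fun x hx => (hA x hx).trans_le hn, C, hC, σ, hσ,
      fun B hB' => ih (hB B hB') (by omega)⟩

/-- A successful derivation subtree of the tree for `A ∈ At(n)` is a proof of `A`. -/
theorem Program.exists_provable_of_successful {P : Program L} {n : ℕ} {A : At L n}
    {T' : DerivationSubtree (P.tree n A)} (h : T'.Successful) : ∃ k, P.Provable n k A := by
  obtain ⟨hfin, -, hleaf⟩ := h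
  obtain ⟨K, hK⟩ := (hfin.image fun x => x.1).bddAbove
  have hlt : ∀ k, ∀ x ∈ T'.andNodes k, k < K + 1 := fun k x hx =>
    Nat.lt_succ_of_le (hK ⟨⟨k, x⟩, hx, rfl⟩)
  -- Downward induction on the level, starting above the highest nodes.
  have key : ∀ j k, K + 1 ≤ k + j → ∀ x ∈ T'.andNodes k,
      P.Provable n j ((P.tree n A).label x).1 := by
    intro j
    induction j with
    | zero => exact fun k hk x hx => absurd (hlt k x hx) (by omega)
    | succ j ih =>
      intro k hk x hx
      obtain ⟨⟨x', S, hS⟩, hy, hyx⟩ := hleaf k x hx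
      obtain rfl : x' = x := hyx
      obtain ⟨C, hC, σ, hσ, hbody⟩ := id hS
      refine ⟨x'.1.2, C, hC, σ, hσ, fun B hB => ?_⟩
      obtain ⟨b, hb, hbB⟩ : B.subst σ ∈ Subtype.val '' (S : Set (At L n)) :=
        hbody ▸ ⟨B, hB, rfl⟩
      rw [← hbB]
      exact ih (k + 1) (by omega) ⟨b, .step x'.2 S hS b hb⟩ (T'.all_children k _ hy)
  exact ⟨K + 1, key (K + 1) 0 (by omega) _ T'.root_mem⟩

/-- From a proof of `A` in `At(n)`, choosing a last step of a proof of least height for each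
provable atom determines a successful derivation subtree. -/
theorem Program.exists_successful_of_provable {P : Program L} {n k : ℕ} {A : At L n}
    (h : P.Provable n k A) : ∃ T' : DerivationSubtree (P.tree n A), T'.Successful := by
  classical
  have hstep : ∀ b : At L n, (∃ k, P.Provable n k b) → ∃ S ∈ P.coalgebra n b, ∀ b' ∈ S,
      (∃ k, P.Provable n k b') ∧
        sInf {k | P.Provable n k b'} < sInf {k | P.Provable n k b} := by
    intro b hb
    have hmin : P.Provable n (sInf {k | P.Provable n k b}) b := Nat.sInf_mem hb
    generalize sInf {k | P.Provable n k b} = j at hmin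
    cases j with
    | zero => exact hmin.elim
    | succ j =>
      obtain ⟨-, C, hC, σ, hσ, hB⟩ := hmin
      have hfin : {b' : At L n | ∃ B ∈ C.body, B.subst σ = b'}.Finite := by
        refine Set.Finite.of_finite_image (f := Subtype.val) ?_ Subtype.val_injective.injOn
        refine ((List.finite_toSet C.body).image (·.subst σ)).subset ?_
        rintro _ ⟨b', ⟨B, hB, hb'⟩, rfl⟩
        exact ⟨B, hB, hb'⟩
      refine ⟨hfin.toFinset, ⟨C, hC, σ, hσ, ?_⟩, ?_⟩
      · ext B'
        simp only [Set.Finite.coe_toFinset]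
        constructor
        · rintro ⟨b', ⟨B, hB, hb'⟩, rfl⟩
          exact ⟨B, hB, hb'⟩
        · rintro ⟨B, hB', rfl⟩
          exact ⟨⟨_, (hB B hB').mem_At⟩, ⟨B, hB', rfl⟩, rfl⟩
      · intro b' hb'
        obtain ⟨B, hB', hBb⟩ := hfin.mem_toFinset.1 hb'
        have hp : P.Provable n j b' := hBb ▸ hB B hB'
        exact ⟨⟨j, hp⟩, Nat.lt_succ_of_le (Nat.sInf_le hp)⟩
  choose! s hs hs' using hstep
  exact ⟨followSubtree _ A s,
    followSubtree_successful (good := fun b => ∃ k, P.Provable n k b) ⟨k, h⟩ hs hs'⟩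

/-! ### Soundness -/

/-- The heads of clause instances with provable bodies are provable.  That an atom has a proof is
expressed by `∀ᶠ m in atTop, P.Provable m m A`: all large enough `m` bound both the height of the
proof and the variables in it. -/
theorem Program.eventually_provable_of_body {P : Program L} {C : Clause L} (hC : C ∈ P.clauses)
    {σ : Subst L} (h : ∀ B ∈ C.body, ∀ᶠ m in atTop, P.Provable m m (B.subst σ)) :
    ∀ᶠ m in atTop, P.Provable m m (C.head.subst σ) := by
  have hbody : ∀ᶠ m in atTop, ∀ B ∈ C.body, P.Provable m m (B.subst σ) :=
    (eventually_all_finite (List.finite_toSet C.body)).2 h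
  obtain ⟨m, hm⟩ := hbody.exists
  obtain ⟨b, hb⟩ := (C.head.subst σ).finite_vars.bddAbove
  refine eventually_atTop.2 ⟨m + b + 1, fun m' hm' => ?_⟩
  obtain ⟨j, rfl⟩ : ∃ j, m' = j + 1 := ⟨m' - 1, by omega⟩
  refine ⟨fun x hx => ?_, C, hC, σ, rfl, fun B hB => (hm B hB).mono (by omega) (by omega)⟩
  have := hb hx
  omega

/-- The composite `θᵢ θᵢ₊₁ ⋯ θᵢ₊ⱼ₋₁` of `j` members of a sequence of substitutions. -/
def compositeFrom (θ : ℕ → Subst L) : ℕ → ℕ → Subst L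
  | _, 0 => Subst.id
  | i, j + 1 => (θ i).comp (compositeFrom θ (i + 1) j)

theorem composite_comp_compositeFrom (θ : ℕ → Subst L) (i j : ℕ) :
    (composite θ i).comp (compositeFrom θ i j) = composite θ (i + j) := by
  induction j generalizing i with
  | zero => exact Subst.comp_id _
  | succ j ih =>
    have := ih (i + 1)
    rw [composite, Subst.comp_assoc] at this
    rw [compositeFrom, this]
    congr 1
    omega

theorem Clause.IsVariant.exists_subst {C' C : Clause L} (h : C'.IsVariant C) (τ : Subst L) :
    ∃ σ : Subst L, C'.subst τ = C.subst σ := by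
  obtain ⟨ρ, -, rfl⟩ := h
  refine ⟨Subst.comp (fun x => Term.var (ρ x)) τ, ?_⟩
  simp [Clause.subst, Atom.subst_comp, Function.comp_def]

theorem Goal.eq_take_append_get_cons_drop (G : Goal L) (i : Fin G.length) :
    G = G.take i ++ G.get i :: G.drop (i + 1) := by
  conv_lhs => rw [← List.take_append_drop i G, List.drop_eq_getElem_cons i.2]
  rfl

theorem Goal.mem_iff_eq_get_or_mem {G : Goal L} (i : Fin G.length) {A : Atom L} :
    A ∈ G ↔ A = G.get i ∨ A ∈ G.take i ++ G.drop (i + 1) := by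
  conv_lhs => rw [Goal.eq_take_append_get_cons_drop G i]
  simp only [List.mem_append, List.mem_cons]
  tauto

/-- Backwards along a refutation, the instances of the atoms of each goal under the composite of the
mgu's that are still to come are provable. -/
theorem SLDRefutation.eventually_provable {P : Program L} {R : SelectionRule L} {G : Goal L}
    {N : ℕ} (D : SLDRefutation P R G N) (j i : ℕ) (hij : i + j = N) :
    ∀ A ∈ D.goal i, ∀ᶠ m in atTop, P.Provable m m (A.subst (compositeFrom D.mgu i j)) := by
  induction j generalizing i with
  | zero =>
    obtain rfl : i = N := hij
    simp [D.goal_last]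
  | succ j ih =>
    have ih := ih (i + 1) (by omega)
    obtain ⟨hne, hmgu, hgoal⟩ := D.step i (by omega)
    obtain ⟨C, hC, hvar⟩ := D.variant i (by omega)
    simp only [hgoal, List.forall_mem_map, ← Atom.subst_comp] at ih
    change ∀ A : Atom L, A ∈ _ → ∀ᶠ m in atTop,
      P.Provable m m (A.subst (compositeFrom D.mgu i (j + 1))) at ih
    intro A hA
    rcases (Goal.mem_iff_eq_get_or_mem (R (D.goal i) hne)).1 hA with rfl | hA
    · obtain ⟨σ, hσ⟩ := hvar.exists_subst (compositeFrom D.mgu i (j + 1))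
      simp only [Clause.subst, Clause.mk.injEq] at hσ
      have hu := isUnifier_pair.1 hmgu.1
      rw [compositeFrom, Atom.subst_comp, hu, ← Atom.subst_comp, ← compositeFrom, hσ.1]
      refine Program.eventually_provable_of_body hC fun B hB => ?_
      have hBσ : B.subst σ ∈ C.body.map (·.subst σ) := List.mem_map_of_mem hB
      rw [← hσ.2] at hBσ
      obtain ⟨B', hB', h⟩ := List.mem_map.1 hBσ
      rw [← h]
      exact ih B' (by simp [hB'])
    · refine ih A ?_
      simp only [List.mem_append] at hA ⊢
      tauto

theorem SLDRefutation.exists_successful {P : Program L} {R : SelectionRule L} {G : Atom L}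
    {N : ℕ} (D : SLDRefutation P R [G] N) :
    ∃ (n : ℕ) (h : G.subst D.computedAnswer ∈ At L n)
      (T' : DerivationSubtree (P.tree n ⟨G.subst D.computedAnswer, h⟩)), T'.Successful := by
  have hG := D.eventually_provable N 0 (by omega) G (by simp [D.goal_zero])
  have hcomp : compositeFrom D.mgu 0 N = D.computedAnswer := by
    have := composite_comp_compositeFrom D.mgu 0 N
    rwa [Nat.zero_add] at this
  obtain ⟨n, hn⟩ := hG.exists
  rw [hcomp] at hn
  exact ⟨n, hn.mem_At, Program.exists_successful_of_provable (A := ⟨_, hn.mem_At⟩) hn⟩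

/-! ### Completeness -/

/-- Provable atoms have weights such that each of them is the head of a clause instance whose body
is provable and of smaller total weight.  The weight of an atom is `M ^ r`, where `r` is the least
height of its proofs and `M` exceeds the lengths of the clause bodies of the program. -/
theorem Program.exists_weight (P : Program L) (n : ℕ) : ∃ w : Atom L → ℕ,
    ∀ A, (∃ k, P.Provable n k A) → ∃ C ∈ P.clauses, ∃ σ : Subst L, C.head.subst σ = A ∧
      (∀ B ∈ C.body.map (·.subst σ), ∃ k, P.Provable n k B) ∧
      ((C.body.map (·.subst σ)).map w).sum < w A := by
  refine ⟨fun A => (P.clauses.sup (fun C => C.body.length) + 1) ^ sInf {k | P.Provable n k A},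
    fun A hA => ?_⟩
  have hmin : P.Provable n (sInf {k | P.Provable n k A}) A := Nat.sInf_mem hA
  generalize hr : sInf {k | P.Provable n k A} = r at hmin
  cases r with
  | zero => exact hmin.elim
  | succ r =>
    obtain ⟨-, C, hC, σ, hσ, hB⟩ := hmin
    have hB' : ∀ B ∈ C.body.map (·.subst σ), P.Provable n r B := List.forall_mem_map.2 hB
    refine ⟨C, hC, σ, hσ, fun B h => ⟨r, hB' B h⟩, ?_⟩
    have hlen : C.body.length ≤ P.clauses.sup fun C => C.body.length :=
      Finset.le_sup (f := fun C : Clause L => C.body.length) hC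
    beta_reduce
    rw [hr]
    generalize P.clauses.sup (fun C => C.body.length) = M at hlen ⊢
    calc _ ≤ _ := List.sum_le_card_nsmul _ ((M + 1) ^ r)
            (List.forall_mem_map.2 fun B h =>
              Nat.pow_le_pow_right (Nat.succ_pos M) (Nat.sInf_le (hB' B h)))
      _ = C.body.length * (M + 1) ^ r := by simp
      _ < (M + 1) * (M + 1) ^ r :=
        Nat.mul_lt_mul_of_pos_right (by omega) (pow_pos (Nat.succ_pos M) r)
      _ = (M + 1) ^ (r + 1) := (pow_succ' _ _).symm

theorem composite_congr {θ γ : ℕ → Subst L} {k : ℕ} (h : ∀ j < k, θ j = γ j) :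
    composite θ k = composite γ k := by
  induction k with
  | zero => rfl
  | succ k ih => rw [composite, composite, ih fun j hj => h j (by omega), h k (by omega)]

theorem mem_varFinset_composite {θ : ℕ → Subst L} {k x y : ℕ}
    (hy : y ∈ (composite θ k x).varFinset) : y = x ∨ ∃ j < k, y ∈ (θ j).vars := by
  induction k generalizing y with
  | zero => exact .inl (by simpa [composite, Subst.id, Term.varFinset] using hy)
  | succ k ih =>
    rcases mem_or_mem_vars_of_mem_subst hy with h | h
    · exact (ih h).imp_right fun ⟨j, hj, h⟩ => ⟨j, by omega, h⟩
    · exact .inr ⟨k, by omega, h⟩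

/-- The variables that appear in a derivation: in its goals, clause variants and mgu's. -/
def SLDDerivation.usedVars {P : Program L} {R : SelectionRule L} {G : Goal L} {N : ℕ}
    (D : SLDDerivation P R G N) : Set ℕ :=
  {x | (∃ j ≤ N, ∃ A ∈ D.goal j, x ∈ A.vars) ∨ (∃ j < N, x ∈ (D.clause j).vars) ∨
    ∃ j < N, x ∈ (D.mgu j).vars}

theorem SLDDerivation.finite_usedVars {P : Program L} {R : SelectionRule L} {G : Goal L} {N : ℕ}
    (D : SLDDerivation P R G N) (hD : ∀ j < N, (D.mgu j).vars.Finite) : D.usedVars.Finite := by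
  have h1 : (⋃ j ∈ Set.Iic N, ⋃ A ∈ {A | A ∈ D.goal j}, A.vars).Finite :=
    (Set.finite_Iic N).biUnion fun j _ =>
      (List.finite_toSet (D.goal j)).biUnion fun A _ => A.finite_vars
  have h2 : (⋃ j ∈ Set.Iio N, (D.clause j).vars).Finite :=
    (Set.finite_Iio N).biUnion fun j _ => (D.clause j).finite_vars
  have h3 : (⋃ j ∈ Set.Iio N, (D.mgu j).vars).Finite :=
    (Set.finite_Iio N).biUnion fun j hj => hD j hj
  refine (h1.union (h2.union h3)).subset ?_
  rintro x (⟨j, hj, A, hA, hx⟩ | ⟨j, hj, hx⟩ | ⟨j, hj, hx⟩)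
  · exact .inl (Set.mem_biUnion hj (Set.mem_biUnion hA hx))
  · exact .inr (.inl (Set.mem_biUnion hj hx))
  · exact .inr (.inr (Set.mem_biUnion hj hx))

/-- A derivation of length `N`, followed by one more step. -/
def SLDDerivation.snoc {P : Program L} {R : SelectionRule L} {G : Goal L} {N : ℕ}
    (D : SLDDerivation P R G N) (C : Clause L) (θ : Subst L) (G' : Goal L)
    (hvar : ∃ C₀ ∈ P.clauses, C.IsVariant C₀) (hfresh : ∀ x ∈ C.vars, x ∉ D.usedVars)
    (hstep : DerivedFrom R (D.goal N) C θ G') : SLDDerivation P R G (N + 1) where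
  goal i := if i ≤ N then D.goal i else G'
  clause i := if i < N then D.clause i else C
  mgu i := if i < N then D.mgu i else θ
  goal_zero := by simp [D.goal_zero]
  variant i hi := by
    split_ifs with h
    · exact D.variant i h
    · exact hvar
  apart i hi x hx := by
    by_cases h : i < N
    · rw [if_pos h] at hx
      obtain ⟨h1, h2, h3⟩ := D.apart i h x hx
      refine ⟨fun j hj => ?_, fun j hj => ?_, fun j hj => ?_⟩
      · rw [if_pos (by omega)]; exact h1 j hj
      · rw [if_pos (by omega)]; exact h2 j hj
      · rw [if_pos (by omega)]; exact h3 j hj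
    · obtain rfl : i = N := by omega
      rw [if_neg h] at hx
      have hx := hfresh x hx
      refine ⟨fun j hj A hA hxA => hx ?_, fun j hj hxj => hx ?_, fun j hj hxj => hx ?_⟩
      · rw [if_pos hj] at hA
        exact .inl ⟨j, hj, A, hA, hxA⟩
      · rw [if_pos hj] at hxj
        exact .inr (.inl ⟨j, hj, hxj⟩)
      · rw [if_pos hj] at hxj
        exact .inr (.inr ⟨j, hj, hxj⟩)
  step i hi := by
    by_cases h : i < N
    · rw [if_pos h.le, if_pos h, if_pos h, if_pos (by omega)]
      exact D.step i h
    · obtain rfl : i = N := by omega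
      rw [if_pos le_rfl, if_neg h, if_neg h, if_neg (by omega)]
      exact hstep

/-- The lifting of one resolution step: a step on the `τ`-instance of the last goal of a derivation,
by an instance of a program clause whose head is equal to the selected atom, comes from a step on
that goal itself. -/
theorem SLDDerivation.exists_lift {P : Program L} {R : SelectionRule L} {G : Goal L} {N : ℕ}
    (D : SLDDerivation P R G N) (hD : ∀ j < N, (D.mgu j).vars.Finite) (τ : Subst L)
    (hne : D.goal N ≠ []) {C : Clause L} (hC : C ∈ P.clauses) {σ : Subst L}
    (hσ : C.head.subst σ = ((D.goal N).get (R _ hne)).subst τ) :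
    ∃ (D' : SLDDerivation P R G (N + 1)) (τ' : Subst L),
      (∀ j < N + 1, (D'.mgu j).vars.Finite) ∧
      (D'.goal (N + 1)).map (·.subst τ') =
        ((D.goal N).take (R _ hne)).map (·.subst τ) ++ C.body.map (·.subst σ) ++
          ((D.goal N).drop (R _ hne + 1)).map (·.subst τ) ∧
      ∀ A ∈ G, ∀ x ∈ A.vars,
        (composite D'.mgu (N + 1)).comp τ' x = (composite D.mgu N).comp τ x := by
  obtain ⟨b, hb⟩ := (D.finite_usedVars hD).bddAbove
  -- The variables of the clause are shifted beyond those used so far; `ρ` is `τ` on the old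
  -- variables and acts on the shifted ones as `σ` does on the original ones.
  set m := b + 1 with hm
  have hlt : ∀ x ∈ D.usedVars, x < m := fun x hx => Nat.lt_succ_of_le (hb hx)
  set C' := C.subst (fun x => Term.var (x + m)) with hC'
  let ρ : Subst L := fun y => if y < m then τ y else σ (y - m)
  have hρτ : ∀ A : Atom L, A ∈ D.goal N → A.subst ρ = A.subst τ := fun A hA =>
    Atom.subst_congr fun x hx => if_pos (hlt x (.inl ⟨N, le_rfl, A, hA, hx⟩))
  have hρσ : ∀ A : Atom L, (A.subst fun x => Term.var (x + m)).subst ρ = A.subst σ := fun A => by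
    rw [← Atom.subst_comp]
    exact Atom.subst_congr fun x _ => by simp [Subst.comp, Term.subst, ρ]
  have hfresh : ∀ x ∈ C'.vars, x ∉ D.usedVars := by
    have key : ∀ (A : Atom L) (x : ℕ), x ∈ (A.subst fun x => Term.var (x + m)).vars → m ≤ x := by
      intro A x hx
      obtain ⟨y, -, hy⟩ := Atom.mem_vars_subst.1 hx
      have : x = y + m := by simpa [Term.varFinset] using hy
      omega
    intro x hx hx'
    have := hlt x hx'
    rcases hx with hx | ⟨B, hB, hx⟩
    · have := key _ x hx
      omega
    · obtain ⟨B, -, rfl⟩ := List.mem_map.1 hB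
      have := key _ x hx
      omega
  have hunif : ((D.goal N).get (R _ hne)).subst ρ = C'.head.subst ρ := by
    rw [hρτ _ (List.get_mem _ _), ← hσ]
    exact (hρσ C.head).symm
  obtain ⟨θ, hfin, hmgu⟩ := exists_isMGU hunif
  obtain ⟨τ', hτ'⟩ := hmgu.2 ρ (isUnifier_pair.2 hunif)
  refine ⟨D.snoc C' θ _ ⟨C, hC, (· + m), (add_left_injective m).injOn, rfl⟩ hfresh
    ⟨hne, hmgu, rfl⟩, τ', fun j hj => ?_, ?_, fun A hA x hx => ?_⟩
  · simp only [snoc]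
    split_ifs with h
    · exact hD j h
    · exact hfin
  · simp only [snoc, if_neg (Nat.not_succ_le_self N), List.map_map, Function.comp_def,
      ← Atom.subst_comp, ← hτ', List.map_append]
    congr 1
    · congr 1
      · exact List.map_congr_left fun A hA => hρτ A (List.mem_of_mem_take hA)
      · simp only [hC', Clause.subst, List.map_map, Function.comp_def, hρσ]
    · exact List.map_congr_left fun A hA => hρτ A (List.mem_of_mem_drop hA)
  · have hcomp : composite (D.snoc C' θ _ ⟨C, hC, (· + m), (add_left_injective m).injOn, rfl⟩
        hfresh ⟨hne, hmgu, rfl⟩).mgu N = composite D.mgu N :=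
      composite_congr fun j hj => if_pos hj
    rw [composite, hcomp]
    simp only [snoc, if_neg (lt_irrefl N)]
    rw [Subst.comp_assoc, ← hτ']
    refine term_subst_congr fun y hy => if_pos (hlt y ?_)
    rcases mem_varFinset_composite hy with rfl | h
    · exact .inl ⟨0, Nat.zero_le N, A, by rwa [D.goal_zero], hx⟩
    · exact .inr (.inr h)

/-- A derivation whose last goal has a provable instance extends to a refutation whose computed
answer is at least as general as that of the derivation followed by the instantiation. -/
theorem SLDDerivation.exists_refutation {P : Program L} {R : SelectionRule L} {G : Goal L} {n : ℕ}
    {w : Atom L → ℕ}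
    (hw : ∀ A, (∃ k, P.Provable n k A) → ∃ C ∈ P.clauses, ∃ σ : Subst L, C.head.subst σ = A ∧
      (∀ B ∈ C.body.map (·.subst σ), ∃ k, P.Provable n k B) ∧
      ((C.body.map (·.subst σ)).map w).sum < w A) (s : ℕ) :
    ∀ {N : ℕ} (D : SLDDerivation P R G N), (∀ j < N, (D.mgu j).vars.Finite) → ∀ τ : Subst L,
      (∀ A ∈ (D.goal N).map (·.subst τ), ∃ k, P.Provable n k A) →
      (((D.goal N).map (·.subst τ)).map w).sum = s →
      ∃ (N' : ℕ) (D' : SLDRefutation P R G N') (σ : Subst L), ∀ A ∈ G, ∀ x ∈ A.vars,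
        D'.computedAnswer.comp σ x = (composite D.mgu N).comp τ x := by
  induction s using Nat.strong_induction_on with
  | _ s ih =>
    intro N D hD τ hprov hs
    by_cases hne : D.goal N = []
    · exact ⟨N, { D with goal_last := hne }, τ, fun _ _ _ _ => rfl⟩
    obtain ⟨C, hC, σ, hσ, hbody, hlt⟩ := hw _ (hprov _ (List.mem_map_of_mem
      (List.get_mem (D.goal N) (R _ hne))))
    obtain ⟨D', τ', hD', hgoal, hans⟩ := D.exists_lift hD τ hne hC hσ
    have hsum := hs
    rw [Goal.eq_take_append_get_cons_drop (D.goal N) (R _ hne)] at hsum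
    simp only [List.map_append, List.map_cons, List.sum_append, List.sum_cons] at hsum
    obtain ⟨N', D'', σ', h⟩ := ih _ (by
      rw [hgoal]
      simp only [List.map_append, List.sum_append]
      omega) D' hD' τ' (fun A hA => by
        rw [hgoal] at hA
        simp only [List.mem_append] at hA
        rcases hA with (hA | hA) | hA
        · obtain ⟨B, hB, rfl⟩ := List.mem_map.1 hA
          exact hprov _ (List.mem_map_of_mem (List.mem_of_mem_take hB))
        · exact hbody A hA
        · obtain ⟨B, hB, rfl⟩ := List.mem_map.1 hA
          exact hprov _ (List.mem_map_of_mem (List.mem_of_mem_drop hB))) rfl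
    exact ⟨N', D'', σ', fun A hA x hx => (h A hA x hx).trans (hans A hA x hx)⟩

/-- The derivation of length `0` from an atomic goal. -/
def SLDDerivation.nil (P : Program L) (R : SelectionRule L) (G : Atom L) :
    SLDDerivation P R [G] 0 where
  goal _ := [G]
  clause _ := ⟨G, []⟩
  mgu _ := Subst.id
  goal_zero := rfl
  variant _ hi := absurd hi (Nat.not_lt_zero _)
  apart _ hi := absurd hi (Nat.not_lt_zero _)
  step _ hi := absurd hi (Nat.not_lt_zero _)

theorem Program.exists_refutation_of_provable {P : Program L} (R : SelectionRule L) {G : Atom L}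
    {θ : Subst L} {n k : ℕ} (h : P.Provable n k (G.subst θ)) :
    ∃ (N : ℕ) (D : SLDRefutation P R [G] N) (σ : Subst L),
      ∀ x ∈ G.vars, D.computedAnswer.comp σ x = θ x := by
  obtain ⟨w, hw⟩ := P.exists_weight n
  obtain ⟨N, D, σ, hσ⟩ := (SLDDerivation.nil P R G).exists_refutation hw _
    (fun j hj => absurd hj (Nat.not_lt_zero j)) θ
    (by simpa [SLDDerivation.nil] using ⟨k, h⟩) rfl
  exact ⟨N, D, σ, fun x hx => hσ G (List.mem_singleton.2 rfl) x hx⟩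

end CoLP

theorem mainTheorem6 {L : FirstOrder.Language.{u, v}} (P : CoLP.Program L)
    (R : CoLP.SelectionRule L) (G : CoLP.Atom L) :
    (∀ (N : ℕ) (D : CoLP.SLDRefutation P R [G] N),
      ∃ (n : ℕ) (h : G.subst D.computedAnswer ∈ CoLP.At L n)
        (T' : CoLP.DerivationSubtree (P.tree n ⟨G.subst D.computedAnswer, h⟩)),
        T'.Successful) ∧
    (∀ (θ : CoLP.Subst L) (n : ℕ) (h : G.subst θ ∈ CoLP.At L n)
      (T' : CoLP.DerivationSubtree (P.tree n ⟨G.subst θ, h⟩)), T'.Successful →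
        ∃ (N : ℕ) (D : CoLP.SLDRefutation P R [G] N) (σ : CoLP.Subst L),
          ∀ x ∈ G.vars, D.computedAnswer.comp σ x = θ x) :=
  ⟨fun _ D => D.exists_successful, fun _ _ _ _ hT' =>
    let ⟨_, hk⟩ := CoLP.Program.exists_provable_of_successful hT'
    CoLP.Program.exists_refutation_of_provable R hk⟩
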